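/- Consider finite sets $\tau=\{\tau_1,\dots,\tau_n\}$ of sporadic tasks $\tau_i=(e_i,d_i,p_i)$ with worst-case execution time $e_i>0$, relative deadline $d_i>0$ and minimum inter-arrival time $p_i>0$; all tasks have constrained deadlines ($d_i\le p_i$) and are indexed so that $d_1\le d_2\le\dots\le d_n$. Call $\tau$ feasible on $m$ processors of speed one if every legal job sequence of $\tau$ (successive releases of $\tau_i$ at least $p_i$ apart, each job of $\tau_i$ requiring at most $e_i$ units of execution) has a preemptive schedule on $m$ identical unit-speed processors, migration being allowed but no job executing on two processors simultaneously, in which every job receives its execution within $d_i$ time units of its release. For a set $\sigma$ of tasks let $dbf^*(\sigma,t)=\sum_{\tau_j\in\sigma,\ d_j\le t}\left(\frac{t-d_j}{p_j}+1\right)e_j$. Deadline-Monotonic Partitioning (partitioned EDF) on $m$ unit-speed processors starts with $\tau(k)=\emptyset$ for $1\le k\le m$ and, for $i=1,\dots,n$ in this order, adds $\tau_i$ to $\tau(k)$ for the smallest $k$ with $e_i+dbf^*(\tau(k),d_i)\le d_i$; it fails if no such $k$ exists, and succeeds if all tasks get assigned. On processors of speed $s$ it is run with every $e_i$ replaced by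 $e_i/s$. Its speedup factor on $m$ processors is the infimum of all $s\ge 1$ such that it succeeds on $m$ processors of speed $s$ for every constrained-deadline task set that is feasible on $m$ processors of speed one. Then for every $m\ge 1$ the speedup factor of Deadline-Monotonic Partitioning on $m$ identical processors is at most $2.5556-\frac1m$. Moreover, for every speed $s\ge 2.5556-\frac1m$, the algorithm succeeds on $m$ processors of speed $s$ for every constrained-deadline task set that is feasible on $m$ processors of speed one. -/

import Mathlib

open MeasureTheory

/-- A sporadic task: worst-case execution time `e`, relative deadline `d`, and
minimum inter-arrival separation (period) `p`. -/
structure SporadicTask where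
  e : ℝ
  d : ℝ
  p : ℝ

/-- The task has positive parameters and a constrained deadline. -/
structure SporadicTask.IsConstrained (T : SporadicTask) : Prop where
  e_pos : 0 < T.e
  d_pos : 0 < T.d
  p_pos : 0 < T.p
  d_le_p : T.d ≤ T.p

/-- The approximate demand bound function of a task. -/
noncomputable def SporadicTask.dbfStar (T : SporadicTask) (t : ℝ) : ℝ :=
  if t < T.d then 0 else ((t - T.d) / T.p + 1) * T.e

/-- The approximate demand bound function of a (finite) collection of tasks. -/
noncomputable def dbfStar (l : List SporadicTask) (t : ℝ) : ℝ :=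
  (l.map fun T => T.dbfStar t).sum

/-- The task as seen by processors of speed `s`: execution times are divided by `s`. -/
noncomputable def SporadicTask.onSpeed (s : ℝ) (T : SporadicTask) : SporadicTask where
  e := T.e / s
  d := T.d
  p := T.p

/-- A legal sequence of jobs released by the tasks `τ`: job `k` of task `i` is released at
`release i k` and needs `cost i k` units of execution, at most the worst case; successive
releases of the same task are separated by at least its period. The (absolute) deadline of the
job is `release i k + (τ i).d`. -/
structure JobSequence {n : ℕ} (τ : Fin n → SporadicTask) where
  release : Fin n → ℕ → ℝ
  cost : Fin n → ℕ → ℝ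
  release_nonneg : ∀ i k, 0 ≤ release i k
  separation : ∀ i k, release i k + (τ i).p ≤ release i (k + 1)
  cost_nonneg : ∀ i k, 0 ≤ cost i k
  cost_le : ∀ i k, cost i k ≤ (τ i).e

/-- A preemptive schedule on `m` identical unit-speed processors, with migration allowed:
`run q t` is the job that processor `q` executes at time `t` (`none` if idle); a job never
executes on two processors at the same time. -/
structure Schedule (n m : ℕ) where
  run : Fin m → ℝ → Option (Fin n × ℕ)
  measurable : ∀ q j, MeasurableSet {t | run q t = some j}
  no_parallel : ∀ t q q' j, run q t = some j → run q' t = some j → q = q'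

/-- The amount of execution that job `j` receives in the time interval `[a, b]`. -/
noncomputable def Schedule.service {n m : ℕ} (S : Schedule n m) (j : Fin n × ℕ) (a b : ℝ) :
    ENNReal :=
  ∑ q : Fin m, volume {t | t ∈ Set.Icc a b ∧ S.run q t = some j}

/-- Every job receives its whole execution requirement between its release and its deadline.
(Time given to a job outside of that interval does not count, i.e. it is wasted.) -/
def Schedule.MeetsDeadlines {n m : ℕ} (S : Schedule n m) {τ : Fin n → SporadicTask}
    (J : JobSequence τ) : Prop :=
  ∀ i k, ENNReal.ofReal (J.cost i k) ≤
    S.service (i, k) (J.release i k) (J.release i k + (τ i).d)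

/-- The task set `τ` is feasible on `m` identical unit-speed processors: every legal job
sequence can be scheduled so that all deadlines are met. -/
def Feasible {n : ℕ} (m : ℕ) (τ : Fin n → SporadicTask) : Prop :=
  ∀ J : JobSequence τ, ∃ S : Schedule n m, S.MeetsDeadlines J

open Classical in
/-- The main loop of Deadline-Monotonic Partitioning on `m` unit-capacity processors: `A k` holds
the tasks assigned so far to processor `k`. The next task `T` goes to the first processor `k`
with `T.e + dbfStar (A k) T.d ≤ T.d`; the result is `none` (FAIL) if there is none. -/
noncomputable def dmPartitionFrom {m : ℕ} :
    List SporadicTask → (Fin m → List SporadicTask) → Option (Fin m → List SporadicTask)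
  | [], A => some A
  | T :: l, A =>
    if h : ∃ k, T.e + dbfStar (A k) T.d ≤ T.d then
      let k := Fin.find (fun k => T.e + dbfStar (A k) T.d ≤ T.d) h
      dmPartitionFrom l (Function.update A k (T :: A k))
    else none

/-- Deadline-Monotonic Partitioning on `m` unit-capacity processors. The tasks are expected to be
listed in non-decreasing order of their relative deadlines. -/
noncomputable def dmPartition (m : ℕ) (l : List SporadicTask) :
    Option (Fin m → List SporadicTask) :=
  dmPartitionFrom l fun _ => []

/-- Deadline-Monotonic Partitioning succeeds on `m` identical processors of speed `s`. -/
def DMSucceeds {n : ℕ} (m : ℕ) (s : ℝ) (τ : Fin n → SporadicTask) : Prop :=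
  (dmPartition m (List.ofFn fun i => (τ i).onSpeed s)).isSome

/-- Every constrained-deadline sporadic task set that is feasible on `m` processors of speed one
(listed in non-decreasing order of relative deadlines, ties in any order) is successfully
partitioned by Deadline-Monotonic Partitioning on `m` processors of speed `s`. -/
def SufficientSpeed (m : ℕ) (s : ℝ) : Prop :=
  ∀ (n : ℕ) (τ : Fin n → SporadicTask), (∀ i, (τ i).IsConstrained) →
    Monotone (fun i => (τ i).d) → Feasible m τ → DMSucceeds m s τ

/-- The speedup factor of Deadline-Monotonic Partitioning on `m` processors: the least
sufficient speed `s ≥ 1`. -/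
noncomputable def speedupFactor (m : ℕ) : ℝ :=
  sInf {s : ℝ | 1 ≤ s ∧ SufficientSpeed m s}

/-! ### Polynomial inequalities -/

/-! If the algorithm fails at task `i`, every processor rejects it. Summing the rejections over the
processors gives `s m d_i < m e_i + ∑_{j<i} dbf*(τ_j, d_i)`. Feasibility yields `e_i ≤ d_i` and,
from the synchronous job sequence, exact demand at most `m t` for all `t`.

The core is `sum_dbfStar_le`, which compares approximate with exact demand by a duality argument.
Rescale so that `d_i = 1`. The positive measure behind `weightedMean` gives `x` the integral `14/9`,
and gives the job count of each task with `d ≤ 1` and `d ≤ p` an integral of at least `(1 - d)/p +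
1`, its approximate count at `1` (`le_weightedMean_jobCount`). Integrating the exact demand bound
therefore gives `∑_{j≤i} dbf*(τ_j, d_i) ≤ (14/9) m d_i`. The term `j = i` equals `e_i`, so `s m d_i
< (m - 1) e_i + (14/9) m d_i`, hence `s < 23/9 - 1/m`, and `23/9 < 2.5556`.

The polynomial inequalities are the cases of the job count estimate, multiplied by `p`, in which the
first three deadlines `d`, `d + p`, `d + 2p` lie differently relative to `1` and `2`. -/

theorem poly_ineq_two_jobs {d p : ℝ} (hd : 0 ≤ d) (hdp : d ≤ p) (h1 : d + p ≤ 1)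
    (h2 : 1 ≤ d + 2 * p) :
    1 - d ≤ p * (7/12*(1-d^2)+7/12*(1-(d+p)^2)+(2-(d+2*p))^2/2+1) := by
  nlinarith [mul_nonneg hd (sub_nonneg.2 hdp), mul_nonneg (sub_nonneg.2 hdp) (sub_nonneg.2 h1),
    mul_nonneg (sub_nonneg.2 h2) (sub_nonneg.2 h1), mul_nonneg hd (sub_nonneg.2 h1),
    mul_nonneg hd (sub_nonneg.2 h2), mul_nonneg (hd.trans hdp) (sq_nonneg (2-d-2*p))]

theorem poly_ineq_short_period {d p : ℝ} (hd : 0 ≤ d) (hdp : d ≤ p) (h1 : 1 ≤ d + p)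
    (h2 : d + 2 * p ≤ 2) :
    1 - d ≤ p * (7/12*(1-d^2)+(2-(d+p))^2/2+(2-(d+2*p))^2/2) := by
  nlinarith [mul_nonneg hd (sub_nonneg.2 hdp), mul_nonneg (sub_nonneg.2 hdp) (sub_nonneg.2 h1),
    mul_nonneg (sub_nonneg.2 h2) (sub_nonneg.2 h1), mul_nonneg hd (sub_nonneg.2 h1),
    mul_nonneg hd (sub_nonneg.2 h2), mul_nonneg (hd.trans hdp) (sq_nonneg (2-d-2*p))]

theorem poly_ineq_medium_period {d p : ℝ} (hd : 0 ≤ d) (hd1 : d ≤ 1) (hdp : d ≤ p)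
    (h1 : d + p ≤ 2) (h2 : 2 ≤ d + 2 * p) :
    1 - d ≤ p * (7/12*(1-d^2)+(2-(d+p))^2/2) := by
  nlinarith [mul_nonneg hd (sub_nonneg.2 hdp), mul_nonneg (sub_nonneg.2 hdp) (sub_nonneg.2 h1),
    mul_nonneg (sub_nonneg.2 h2) (sub_nonneg.2 h1), mul_nonneg hd (sub_nonneg.2 h1),
    mul_nonneg hd (sub_nonneg.2 h2), mul_nonneg (hd.trans hdp) (sq_nonneg (2-d-2*p))]

/-- After removing the factor `1 - d`, it suffices that `p (1 + d) ≥ (2 - d)(1 + d) = 2 + d (1 - d)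
≥ 12/7`. -/
theorem poly_ineq_long_period {d p : ℝ} (hd : 0 ≤ d) (hd1 : d ≤ 1) (h1 : 2 ≤ d + p) :
    1 - d ≤ p * (7/12*(1-d^2)) := by
  nlinarith [mul_nonneg (sub_nonneg.2 hd1) hd,
    mul_nonneg (mul_nonneg (sub_nonneg.2 hd1) hd) (sub_nonneg.2 hd1),
    mul_nonneg (sub_nonneg.2 h1) (mul_nonneg (sub_nonneg.2 hd1) (by linarith : 0 ≤ 1 + d))]

/-! ### A positive linear functional on demand functions -/

/-- Integration against the measure with density `7 x / 6` on `[0, 1]`, density `2 - x` on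
`[1, 2]`, and an atom of mass `1 / 2` at `1`. -/
noncomputable def weightedMean (f : ℝ → ℝ) : ℝ :=
  7/6 * (∫ x in (0:ℝ)..1, x * f x) + f 1 / 2 + ∫ x in (1:ℝ)..2, (2 - x) * f x

theorem Monotone.intervalIntegrable_id_mul {f : ℝ → ℝ} (hf : Monotone f) (a b : ℝ) :
    IntervalIntegrable (fun x => x * f x) volume a b :=
  hf.intervalIntegrable.continuousOn_mul (by fun_prop)

theorem Monotone.intervalIntegrable_sub_mul {f : ℝ → ℝ} (hf : Monotone f) (a b : ℝ) :
    IntervalIntegrable (fun x => (2 - x) * f x) volume a b :=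
  hf.intervalIntegrable.continuousOn_mul (by fun_prop)

theorem weightedMean_mono {f g : ℝ → ℝ} (hf : Monotone f) (hg : Monotone g)
    (h : ∀ x, 0 ≤ x → f x ≤ g x) : weightedMean f ≤ weightedMean g := by
  have h1 : ∫ x in (0:ℝ)..1, x * f x ≤ ∫ x in (0:ℝ)..1, x * g x :=
    intervalIntegral.integral_mono_on zero_le_one (hf.intervalIntegrable_id_mul _ _)
      (hg.intervalIntegrable_id_mul _ _) fun x hx => mul_le_mul_of_nonneg_left (h x hx.1) hx.1
  have h2 : ∫ x in (1:ℝ)..2, (2 - x) * f x ≤ ∫ x in (1:ℝ)..2, (2 - x) * g x :=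
    intervalIntegral.integral_mono_on one_le_two (hf.intervalIntegrable_sub_mul _ _)
      (hg.intervalIntegrable_sub_mul _ _) fun x hx =>
        mul_le_mul_of_nonneg_left (h x (by linarith [hx.1])) (by linarith [hx.2])
  have h3 := h 1 zero_le_one
  unfold weightedMean
  linarith

theorem weightedMean_add {f g : ℝ → ℝ} (hf : Monotone f) (hg : Monotone g) :
    weightedMean (fun x => f x + g x) = weightedMean f + weightedMean g := by
  simp only [weightedMean, mul_add]
  rw [intervalIntegral.integral_add (hf.intervalIntegrable_id_mul _ _)
    (hg.intervalIntegrable_id_mul _ _), intervalIntegral.integral_add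
    (hf.intervalIntegrable_sub_mul _ _) (hg.intervalIntegrable_sub_mul _ _)]
  ring

theorem weightedMean_const_mul (c : ℝ) (f : ℝ → ℝ) :
    weightedMean (fun x => c * f x) = c * weightedMean f := by
  simp only [weightedMean, mul_left_comm _ c, intervalIntegral.integral_const_mul]
  ring

theorem weightedMean_sum {ι : Type*} (s : Finset ι) (f : ι → ℝ → ℝ)
    (hf : ∀ i, Monotone (f i)) :
    weightedMean (fun x => ∑ i ∈ s, f i x) = ∑ i ∈ s, weightedMean (f i) := by
  classical
  induction s using Finset.induction_on with
  | empty => simp [weightedMean]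
  | insert i s hi ih =>
    simp only [Finset.sum_insert hi]
    rw [weightedMean_add (hf i) fun x y h => Finset.sum_le_sum fun j _ => hf j h, ih]

theorem weightedMean_id : weightedMean (fun x => x) = 14 / 9 := by
  have h1 : ∫ x in (0:ℝ)..1, x * x = 1 / 3 := by
    simp only [← sq]; rw [integral_pow]; norm_num
  have h2 : ∫ x in (1:ℝ)..2, (2 - x) * x = 2 / 3 := by
    have : ∀ x : ℝ, (2 - x) * x = 2 * x - x ^ 2 := fun x => by ring
    simp only [this]
    rw [intervalIntegral.integral_sub (Continuous.intervalIntegrable (by fun_prop) _ _)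
      (Continuous.intervalIntegrable (by fun_prop) _ _),
      intervalIntegral.integral_const_mul, integral_id, integral_pow]
    norm_num
  rw [weightedMean, h1, h2]; norm_num

theorem weightedMean_nonneg {f : ℝ → ℝ} (hf : ∀ x, 0 ≤ f x) : 0 ≤ weightedMean f := by
  have h1 : 0 ≤ ∫ x in (0:ℝ)..1, x * f x :=
    intervalIntegral.integral_nonneg zero_le_one fun x hx => mul_nonneg hx.1 (hf x)
  have h2 : 0 ≤ ∫ x in (1:ℝ)..2, (2 - x) * f x :=
    intervalIntegral.integral_nonneg one_le_two fun x hx =>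
      mul_nonneg (by linarith [hx.2]) (hf x)
  have := hf 1
  unfold weightedMean
  linarith

/-! ### Integrals of steps and ramps -/

theorem integral_tail_le {f g : ℝ → ℝ} {a y b : ℝ} (hay : a ≤ y) (hyb : y ≤ b)
    (hf : IntervalIntegrable f volume a b) (h0 : ∀ x ∈ Set.Icc a b, 0 ≤ f x)
    (h : ∀ x ∈ Set.Icc y b, f x = g x) : ∫ x in y..b, g x ≤ ∫ x in a..b, f x := by
  rw [← intervalIntegral.integral_congr (f := f) (by rwa [Set.uIcc_of_le hyb])]
  refine intervalIntegral.integral_mono_interval hay hyb le_rfl ?_ hf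
  filter_upwards [ae_restrict_mem measurableSet_Ioc] with x hx
  exact h0 x ⟨hx.1.le, hx.2⟩

/-- The unit step at `y`. -/
noncomputable def unitStep (y x : ℝ) : ℝ := if x < y then 0 else 1

theorem unitStep_nonneg (y x : ℝ) : 0 ≤ unitStep y x := by
  unfold unitStep; split_ifs <;> norm_num

theorem unitStep_of_le {y x : ℝ} (h : y ≤ x) : unitStep y x = 1 := if_neg h.not_gt

theorem monotone_unitStep (y : ℝ) : Monotone (unitStep y) := by
  intro a b h
  unfold unitStep
  split_ifs <;> linarith

theorem integral_two_sub (y : ℝ) : ∫ x in y..2, (2 - x) = (2 - y) ^ 2 / 2 := by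
  rw [intervalIntegral.integral_sub (Continuous.intervalIntegrable (by fun_prop) _ _)
      (Continuous.intervalIntegrable (by fun_prop) _ _), integral_id,
    intervalIntegral.integral_const]
  simp only [smul_eq_mul]
  ring

/-- The atom at `1` and the density on `[1, 2]` contribute `1/2` each; this `1` pays for the `+ 1`
in the approximate job count. -/
theorem weightedMean_unitStep_early {y : ℝ} (h0 : 0 ≤ y) (h1 : y ≤ 1) :
    1 + 7 / 12 * (1 - y ^ 2) ≤ weightedMean (unitStep y) := by
  have e1 : ∫ x in y..1, x ≤ ∫ x in (0:ℝ)..1, x * unitStep y x :=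
    integral_tail_le h0 h1 ((monotone_unitStep y).intervalIntegrable_id_mul _ _)
      (fun x hx => mul_nonneg hx.1 (unitStep_nonneg _ _))
      fun x hx => by rw [unitStep_of_le hx.1, mul_one]
  have e2 : ∫ x in (1:ℝ)..2, (2 - x) ≤ ∫ x in (1:ℝ)..2, (2 - x) * unitStep y x :=
    integral_tail_le le_rfl one_le_two ((monotone_unitStep y).intervalIntegrable_sub_mul _ _)
      (fun x hx => mul_nonneg (by linarith [hx.2]) (unitStep_nonneg _ _))
      fun x hx => by rw [unitStep_of_le (h1.trans hx.1), mul_one]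
  rw [integral_id] at e1
  rw [integral_two_sub] at e2
  rw [weightedMean, unitStep_of_le h1]
  linarith

theorem weightedMean_unitStep_late {y : ℝ} (h1 : 1 ≤ y) (h2 : y ≤ 2) :
    (2 - y) ^ 2 / 2 ≤ weightedMean (unitStep y) := by
  have e1 : 0 ≤ ∫ x in (0:ℝ)..1, x * unitStep y x :=
    intervalIntegral.integral_nonneg zero_le_one
      fun x hx => mul_nonneg hx.1 (unitStep_nonneg _ _)
  have e2 : ∫ x in y..2, (2 - x) ≤ ∫ x in (1:ℝ)..2, (2 - x) * unitStep y x :=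
    integral_tail_le h1 h2 ((monotone_unitStep y).intervalIntegrable_sub_mul _ _)
      (fun x hx => mul_nonneg (by linarith [hx.2]) (unitStep_nonneg _ _))
      fun x hx => by rw [unitStep_of_le hx.1, mul_one]
  rw [integral_two_sub] at e2
  have := unitStep_nonneg y 1
  rw [weightedMean]
  linarith

theorem monotone_ramp (d : ℝ) : Monotone fun x : ℝ => max 0 (x - d) :=
  fun a b h => max_le_max le_rfl (by linarith)

/-- The summand `1 - d` is split off because `p ((1 - d)/p + 1) = (1 - d) + p`; the bracket is what
remains to cover `p`. -/
theorem weightedMean_ramp {d : ℝ} (h0 : 0 ≤ d) (h1 : d ≤ 1) :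
    1 - d + (5 / 9 - 7 / 12 * d + 7 / 36 * d ^ 3) ≤ weightedMean fun x => max 0 (x - d) := by
  have e1 : ∫ x in d..1, (x ^ 2 - d * x) ≤ ∫ x in (0:ℝ)..1, x * max 0 (x - d) :=
    integral_tail_le h0 h1 ((monotone_ramp d).intervalIntegrable_id_mul _ _)
      (fun x hx => mul_nonneg hx.1 (le_max_left _ _))
      fun x hx => by rw [max_eq_right (by linarith [hx.1])]; ring
  have e2 : ∫ x in (1:ℝ)..2, ((2 + d) * x - x ^ 2 - 2 * d) ≤
      ∫ x in (1:ℝ)..2, (2 - x) * max 0 (x - d) :=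
    integral_tail_le le_rfl one_le_two ((monotone_ramp d).intervalIntegrable_sub_mul _ _)
      (fun x hx => mul_nonneg (by linarith [hx.2]) (le_max_left _ _))
      fun x hx => by rw [max_eq_right (by linarith [hx.1])]; ring
  rw [intervalIntegral.integral_sub (Continuous.intervalIntegrable (by fun_prop) _ _)
      (Continuous.intervalIntegrable (by fun_prop) _ _),
    intervalIntegral.integral_const_mul, integral_id, integral_pow] at e1
  rw [intervalIntegral.integral_sub (Continuous.intervalIntegrable (by fun_prop) _ _)
      (Continuous.intervalIntegrable (by fun_prop) _ _),
    intervalIntegral.integral_sub (Continuous.intervalIntegrable (by fun_prop) _ _)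
      (Continuous.intervalIntegrable (by fun_prop) _ _),
    intervalIntegral.integral_const_mul, integral_id, integral_pow,
    intervalIntegral.integral_const] at e2
  norm_num at e1 e2
  rw [weightedMean, max_eq_right (sub_nonneg.2 h1)]
  linarith

/-! ### The number of jobs of a sporadic task -/

/-- The number of jobs with deadline at most `x` of a task with relative deadline `d` and
period `p` that releases jobs as early as possible from time `0` on. -/
noncomputable def jobCount (d p x : ℝ) : ℕ := if x < d then 0 else ⌊(x - d) / p⌋₊ + 1

theorem jobCount_mono {d p : ℝ} (hp : 0 < p) : Monotone (jobCount d p) := by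
  intro a b h
  unfold jobCount
  split_ifs with ha hb hb
  · exact le_rfl
  · exact Nat.zero_le _
  · exact absurd (h.trans_lt hb) ha
  · gcongr

theorem lt_jobCount_iff {d p x : ℝ} (hp : 0 < p) {k : ℕ} :
    k < jobCount d p x ↔ k * p + d ≤ x := by
  have hk : (0:ℝ) ≤ k * p := by positivity
  unfold jobCount
  split_ifs with h
  · simp only [not_lt_zero, false_iff, not_le]; linarith
  · rw [Nat.lt_succ_iff, Nat.le_floor_iff (div_nonneg (by linarith) hp.le), le_div_iff₀ hp]
    constructor <;> intro <;> linarith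

theorem jobCount_mul {d p : ℝ} {D : ℝ} (hD : 0 < D) (x : ℝ) :
    jobCount d p (D * x) = jobCount (d / D) (p / D) x := by
  have h1 : D * x < d ↔ x < d / D := by rw [lt_div_iff₀ hD, mul_comm]
  have h2 : (D * x - d) / p = (x - d / D) / (p / D) := by field_simp
  simp only [jobCount, h1, h2]

/-- Good for short periods, where rounding matters little: `z ≤ ⌊z⌋ + 1`. -/
theorem ramp_le_jobCount (d p x : ℝ) :
    1 / p * max 0 (x - d) ≤ jobCount d p x := by
  unfold jobCount
  split_ifs with h
  · rw [max_eq_left (by linarith)]; simp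
  · rw [max_eq_right (by linarith)]
    push_cast
    rw [one_div_mul_eq_div]
    exact (Nat.lt_floor_add_one _).le

theorem steps_le_jobCount {d p : ℝ} (hp : 0 < p) (x : ℝ) :
    unitStep d x + (unitStep (d + p) x + unitStep (d + 2 * p) x) ≤ jobCount d p x := by
  by_cases h2 : d + 2 * p ≤ x
  · have : 3 ≤ jobCount d p x := (lt_jobCount_iff hp).2 (by push_cast; linarith)
    have : (3 : ℝ) ≤ jobCount d p x := by exact_mod_cast this
    rw [unitStep_of_le h2, unitStep_of_le (by linarith), unitStep_of_le (by linarith)]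
    linarith
  have e2 : unitStep (d + 2 * p) x = 0 := if_pos (not_le.1 h2)
  by_cases h1 : d + p ≤ x
  · have : 2 ≤ jobCount d p x := (lt_jobCount_iff hp).2 (by push_cast; linarith)
    have : (2 : ℝ) ≤ jobCount d p x := by exact_mod_cast this
    rw [e2, unitStep_of_le h1, unitStep_of_le (by linarith)]
    linarith
  have e1 : unitStep (d + p) x = 0 := if_pos (not_le.1 h1)
  by_cases h0 : d ≤ x
  · have : 1 ≤ jobCount d p x := (lt_jobCount_iff hp).2 (by push_cast; linarith)
    have : (1 : ℝ) ≤ jobCount d p x := by exact_mod_cast this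
    rw [e2, e1, unitStep_of_le h0]
    linarith
  have e0 : unitStep d x = 0 := if_pos (not_le.1 h0)
  rw [e0, e1, e2]
  simp

theorem le_weightedMean_jobCount {d p : ℝ} (hd : 0 < d) (hd1 : d ≤ 1) (hdp : d ≤ p) :
    (1 - d) / p + 1 ≤ weightedMean fun x => jobCount d p x := by
  have hp : 0 < p := hd.trans_le hdp
  have hN : Monotone fun x => (jobCount d p x : ℝ) := Nat.mono_cast.comp (jobCount_mono hp)
  by_cases h2 : d + 2 * p ≤ 1
  -- Here `p ≤ (1 - d)/2` and, as `d ≤ p`, also `d ≤ 1/3`; so the surplus `5/9 - 7d/12` exceeds `p`.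
  · have h := weightedMean_mono (fun a b h => mul_le_mul_of_nonneg_left (monotone_ramp d h)
      (one_div_nonneg.2 hp.le)) hN fun x _ => ramp_le_jobCount d p x
    rw [weightedMean_const_mul] at h
    refine le_trans ?_ h
    rw [one_div_mul_eq_div, le_div_iff₀ hp, add_mul, div_mul_cancel₀ _ hp.ne']
    have := weightedMean_ramp hd.le hd1
    have := pow_pos hd 3
    linarith
  rw [not_le] at h2
  have h := weightedMean_mono ((monotone_unitStep d).add ((monotone_unitStep (d + p)).add
    (monotone_unitStep (d + 2 * p)))) hN fun x _ => steps_le_jobCount hp x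
  rw [weightedMean_add (monotone_unitStep d) ((monotone_unitStep (d + p)).add
    (monotone_unitStep (d + 2 * p))), weightedMean_add (monotone_unitStep _)
    (monotone_unitStep _)] at h
  refine le_trans ?_ h
  have hdiv : p * ((1 - d) / p + 1) = 1 - d + p := by field_simp
  refine le_of_mul_le_mul_left ?_ hp
  rw [hdiv, mul_add, mul_add]
  have s0 := mul_le_mul_of_nonneg_left (weightedMean_unitStep_early hd.le hd1) hp.le
  -- Steps located beyond `2` are merely bounded below by `0`.
  have n1 := mul_nonneg hp.le (weightedMean_nonneg (unitStep_nonneg (d + p)))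
  have n2 := mul_nonneg hp.le (weightedMean_nonneg (unitStep_nonneg (d + 2 * p)))
  rcases le_total (d + p) 1 with h1 | h1
  · have s1 := mul_le_mul_of_nonneg_left
      (weightedMean_unitStep_early (y := d + p) (by linarith) h1) hp.le
    have s2 := mul_le_mul_of_nonneg_left
      (weightedMean_unitStep_late (y := d + 2 * p) (by linarith) (by linarith)) hp.le
    linarith [poly_ineq_two_jobs hd.le hdp h1 h2.le]
  rcases le_total 2 (d + p) with h3 | h3
  · linarith [poly_ineq_long_period hd.le hd1 h3]
  have s1 := mul_le_mul_of_nonneg_left (weightedMean_unitStep_late h1 h3) hp.le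
  rcases le_total 2 (d + 2 * p) with h4 | h4
  · linarith [poly_ineq_medium_period hd.le hd1 hdp h3 h4]
  · have s2 := mul_le_mul_of_nonneg_left (weightedMean_unitStep_late h2.le h4) hp.le
    linarith [poly_ineq_short_period hd.le hdp h1 h4]

/-- If the demand of constrained-deadline tasks never exceeds `M` times the elapsed time, then
at any time `D` past all relative deadlines the approximate demand is at most `14 / 9 * M * D`. -/
theorem sum_dbfStar_le {ι : Type*} (s : Finset ι) (τ : ι → SporadicTask)
    (hτ : ∀ i, (τ i).IsConstrained) {M D : ℝ} (hD : 0 < D) (hdD : ∀ i ∈ s, (τ i).d ≤ D)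
    (h : ∀ t, 0 ≤ t → ∑ i ∈ s, (τ i).e * jobCount (τ i).d (τ i).p t ≤ M * t) :
    ∑ i ∈ s, (τ i).dbfStar D ≤ 14 / 9 * (M * D) := by
  have hmono : ∀ i, Monotone fun x => (τ i).e * (jobCount (τ i).d (τ i).p (D * x) : ℝ) :=
    fun i a b hab => mul_le_mul_of_nonneg_left (Nat.cast_le.2
      (jobCount_mono (hτ i).p_pos (mul_le_mul_of_nonneg_left hab hD.le))) (hτ i).e_pos.le
  have hid : weightedMean (fun x => ∑ i ∈ s, (τ i).e * jobCount (τ i).d (τ i).p (D * x)) ≤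
      14 / 9 * (M * D) := by
    rw [mul_comm, ← weightedMean_id, ← weightedMean_const_mul]
    -- The sign of `M` is not assumed; it follows from nonnegative demand at `D`.
    have hMD : 0 ≤ M * D := (Finset.sum_nonneg fun i _ =>
      mul_nonneg (hτ i).e_pos.le (Nat.cast_nonneg _)).trans (h D hD.le)
    refine weightedMean_mono (fun a b hab => Finset.sum_le_sum fun i _ => hmono i hab)
      (fun a b hab => mul_le_mul_of_nonneg_left hab hMD) fun x hx => ?_
    rw [mul_assoc]
    exact h _ (by positivity)
  refine le_trans ?_ hid
  rw [weightedMean_sum s _ hmono]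
  refine Finset.sum_le_sum fun i hi => ?_
  rw [weightedMean_const_mul, SporadicTask.dbfStar, if_neg (hdD i hi).not_gt, mul_comm]
  refine mul_le_mul_of_nonneg_left ?_ (hτ i).e_pos.le
  simp only [jobCount_mul hD]
  refine le_trans (le_of_eq ?_) (le_weightedMean_jobCount (div_pos (hτ i).d_pos hD)
    ((div_le_one hD).2 (hdD i hi)) (div_le_div_of_nonneg_right (hτ i).d_le_p hD.le))
  have := (hτ i).p_pos.ne'
  field_simp

/-! ### Necessary conditions for feasibility -/

/-- The job sequence in which every task releases its jobs as early as possible from time `0` on,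
and all jobs need the worst-case execution time. -/
noncomputable def synchronousSequence {n : ℕ} (τ : Fin n → SporadicTask)
    (hτ : ∀ i, (τ i).IsConstrained) : JobSequence τ where
  release i k := k * (τ i).p
  cost i _ := (τ i).e
  release_nonneg i k := mul_nonneg k.cast_nonneg (hτ i).p_pos.le
  separation i k := by push_cast; linarith
  cost_nonneg i _ := (hτ i).e_pos.le
  cost_le _ _ := le_rfl

theorem Schedule.sum_service_le {n m : ℕ} (S : Schedule n m) {ι : Type*} (s : Finset ι)
    (f : ι → Fin n × ℕ) (hf : Function.Injective f) (a b : ℝ) :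
    ∑ j ∈ s, S.service (f j) a b ≤ m * ENNReal.ofReal (b - a) := by
  simp only [Schedule.service]
  rw [Finset.sum_comm]
  have h : ∀ q ∈ (Finset.univ : Finset (Fin m)),
      ∑ j ∈ s, volume {t | t ∈ Set.Icc a b ∧ S.run q t = some (f j)} ≤
        ENNReal.ofReal (b - a) := by
    intro q _
    rw [← measure_biUnion_finset, ← Real.volume_Icc]
    · exact measure_mono (Set.iUnion₂_subset fun j _ t ht => ht.1)
    · intro i _ j _ hij
      rw [Function.onFun, Set.disjoint_left]
      rintro t ⟨_, h1⟩ ⟨_, h2⟩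
      exact hij (hf (Option.some_injective _ (h1.symm.trans h2)))
    · exact fun j _ => measurableSet_Icc.inter (S.measurable q (f j))
  refine (Finset.sum_le_sum h).trans ?_
  simp

theorem Schedule.service_le {n m : ℕ} (S : Schedule n m) (j : Fin n × ℕ) (a b : ℝ) :
    S.service j a b ≤ ENNReal.ofReal (b - a) := by
  rw [Schedule.service, ← tsum_fintype (L := .unconditional _), ← measure_iUnion,
    ← Real.volume_Icc]
  · exact measure_mono (Set.iUnion_subset fun q t ht => ht.1)
  · intro q q' hq
    rw [Function.onFun, Set.disjoint_left]
    rintro t ⟨_, h1⟩ ⟨_, h2⟩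
    exact hq (S.no_parallel t q q' j h1 h2)
  · exact fun q => measurableSet_Icc.inter (S.measurable q j)

theorem Schedule.service_mono {n m : ℕ} (S : Schedule n m) (j : Fin n × ℕ) {a b a' b' : ℝ}
    (ha : a' ≤ a) (hb : b ≤ b') : S.service j a b ≤ S.service j a' b' :=
  Finset.sum_le_sum fun _ _ => measure_mono fun _ ht =>
    ⟨⟨ha.trans ht.1.1, ht.1.2.trans hb⟩, ht.2⟩

theorem Feasible.e_le_d {n m : ℕ} {τ : Fin n → SporadicTask} (hτ : ∀ i, (τ i).IsConstrained)
    (hF : Feasible m τ) (i : Fin n) : (τ i).e ≤ (τ i).d := by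
  obtain ⟨S, hS⟩ := hF (synchronousSequence τ hτ)
  have h := (hS i 0).trans (S.service_le _ _ _)
  rw [add_sub_cancel_left] at h
  exact (ENNReal.ofReal_le_ofReal_iff (hτ i).d_pos.le).1 h

/-- In the synchronous sequence, each counted job must be served inside `[0, t]`, where `m`
processors offer at most `m t`. -/
theorem Feasible.demand_le {n m : ℕ} {τ : Fin n → SporadicTask}
    (hτ : ∀ i, (τ i).IsConstrained) (hF : Feasible m τ) {t : ℝ} (ht : 0 ≤ t) :
    ∑ i, (τ i).e * jobCount (τ i).d (τ i).p t ≤ m * t := by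
  obtain ⟨S, hS⟩ := hF (synchronousSequence τ hτ)
  rw [← ENNReal.ofReal_le_ofReal_iff (by positivity), ENNReal.ofReal_mul (by positivity),
    ENNReal.ofReal_natCast, ENNReal.ofReal_sum_of_nonneg fun i _ =>
      mul_nonneg (hτ i).e_pos.le (Nat.cast_nonneg _)]
  have hinj : Function.Injective fun j : (_ : Fin n) × ℕ => (j.1, j.2) := by
    rintro ⟨i, k⟩ ⟨i', k'⟩ h
    simpa using h
  have h := S.sum_service_le
    (Finset.univ.sigma fun i => Finset.range (jobCount (τ i).d (τ i).p t)) _ hinj 0 t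
  rw [sub_zero, Finset.sum_sigma] at h
  refine le_trans (Finset.sum_le_sum fun i _ => ?_) h
  rw [mul_comm, ENNReal.ofReal_mul (Nat.cast_nonneg _), ENNReal.ofReal_natCast, ← nsmul_eq_mul]
  refine (le_of_eq (by rw [Finset.card_range])).trans
    (Finset.card_nsmul_le_sum _ _ (ENNReal.ofReal (τ i).e) fun k hk => ?_)
  exact (hS i k).trans (S.service_mono _
    (mul_nonneg k.cast_nonneg (hτ i).p_pos.le)
    ((lt_jobCount_iff (hτ i).p_pos).1 (Finset.mem_range.1 hk)))

/-! ### Failure of Deadline-Monotonic Partitioning -/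

theorem dbfStar_cons (T : SporadicTask) (l : List SporadicTask) (t : ℝ) :
    dbfStar (T :: l) t = T.dbfStar t + dbfStar l t := by
  simp [dbfStar]

/-- Only the total approximate demand is tracked: placing a task adds its own demand to the total
whichever processor receives it, so the first-fit choice plays no role. -/
theorem exists_of_dmPartitionFrom_eq_none {m : ℕ} (l : List SporadicTask)
    (A : Fin m → List SporadicTask) (h : dmPartitionFrom l A = none) :
    ∃ (l₁ : List SporadicTask) (T : SporadicTask) (l₂ : List SporadicTask)
      (B : Fin m → List SporadicTask), l = l₁ ++ T :: l₂ ∧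
      (∀ t, ∑ k, dbfStar (B k) t = ∑ k, dbfStar (A k) t + dbfStar l₁ t) ∧
      ∀ k, T.d < T.e + dbfStar (B k) T.d := by
  induction l generalizing A with
  | nil => simp [dmPartitionFrom] at h
  | cons T l ih =>
    rw [dmPartitionFrom] at h
    split_ifs at h with hk
    · obtain ⟨l₁, T', l₂, B, rfl, hB, hT⟩ := ih _ h
      refine ⟨T :: l₁, T', l₂, B, rfl, fun t => ?_, hT⟩
      rw [hB, dbfStar_cons, ← add_assoc]
      congr 1
      set k₀ := Fin.find (fun k => T.e + dbfStar (A k) T.d ≤ T.d) hk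
      rw [← Finset.add_sum_erase _ _ (Finset.mem_univ k₀),
        ← Finset.add_sum_erase _ (fun k => dbfStar (A k) t) (Finset.mem_univ k₀),
        Function.update_self, dbfStar_cons]
      rw [Finset.sum_congr rfl fun k hk => by
        rw [Function.update_of_ne (Finset.ne_of_mem_erase hk)]]
      ring
    · exact ⟨[], T, l, A, rfl, by simp [dbfStar], fun k => not_le.1 fun h' => hk ⟨k, h'⟩⟩

theorem dbfStar_onSpeed (T : SporadicTask) (s t : ℝ) :
    (T.onSpeed s).dbfStar t = T.dbfStar t / s := by
  unfold SporadicTask.dbfStar SporadicTask.onSpeed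
  split_ifs
  · simp
  · ring

theorem dbfStar_take_ofFn {n : ℕ} (τ : Fin n → SporadicTask) (i : Fin n) (t : ℝ) :
    dbfStar ((List.ofFn τ).take i) t = ∑ j ∈ Finset.Iio i, (τ j).dbfStar t := by
  rw [dbfStar, List.map_take, List.map_ofFn, List.sum_take_ofFn]
  refine Finset.sum_congr ?_ fun _ _ => rfl
  ext j
  simp

/-- If partitioning fails on `m` processors of speed `s`, then the approximate demand of the tasks
up to the first unassigned one fills all processors. -/
theorem exists_of_not_dmSucceeds {n m : ℕ} {s : ℝ} (hs : 0 < s) (hm : 1 ≤ m)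
    {τ : Fin n → SporadicTask} (h : ¬ DMSucceeds m s τ) :
    ∃ i, s * (m * (τ i).d) < m * (τ i).e + ∑ j ∈ Finset.Iio i, (τ j).dbfStar (τ i).d := by
  rw [DMSucceeds, Option.not_isSome_iff_eq_none] at h
  obtain ⟨l₁, T, l₂, B, hl, hB, hT⟩ := exists_of_dmPartitionFrom_eq_none _ _ h
  have hlen : l₁.length < n := by
    have := congrArg List.length hl
    simp only [List.length_ofFn, List.length_append, List.length_cons] at this
    omega
  obtain ⟨i, hi⟩ : ∃ i : Fin n, l₁.length = i := ⟨⟨_, hlen⟩, rfl⟩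
  have hl₁ : l₁ = (List.ofFn fun i => (τ i).onSpeed s).take i := by rw [hl, ← hi]; simp
  obtain rfl : T = (τ i).onSpeed s := by
    have := congrArg (fun l => l[l₁.length]?) hl
    simpa [hi, eq_comm] using this
  refine ⟨i, ?_⟩
  have hsum : ∑ _k : Fin m, (τ i).d < ∑ k, ((τ i).e / s + dbfStar (B k) (τ i).d) :=
    Finset.sum_lt_sum_of_nonempty ⟨⟨0, hm⟩, Finset.mem_univ _⟩ fun k _ => hT k
  rw [Finset.sum_add_distrib, hB, hl₁, dbfStar_take_ofFn] at hsum
  simp only [dbfStar_onSpeed, ← Finset.sum_div] at hsum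
  simp only [dbfStar, List.map_nil, List.sum_nil, Finset.sum_const, Finset.card_univ,
    Fintype.card_fin, nsmul_eq_mul, mul_zero, zero_add] at hsum
  rw [← add_div, lt_div_iff₀ hs] at hsum
  linarith

/-! ### The speedup bound -/

theorem sufficientSpeed_of_le {m : ℕ} (hm : 1 ≤ m) {s : ℝ}
    (hs : 2.5556 - 1 / (m : ℝ) ≤ s) : SufficientSpeed m s := by
  intro n τ hτ hmono hF
  have hm1 : (1 : ℝ) ≤ m := by exact_mod_cast hm
  have hm0 : (0 : ℝ) < m := by linarith
  have hs0 : 0 < s := by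
    have : 1 / (m : ℝ) ≤ 1 := (div_le_one hm0).2 hm1
    linarith
  by_contra h
  obtain ⟨i, hi⟩ := exists_of_not_dmSucceeds hs0 hm h
  have hd := (hτ i).d_pos
  have he := hF.e_le_d hτ i
  -- Deadline order ensures that all tasks up to `i` have deadline at most `D = d_i`.
  have key := sum_dbfStar_le (Finset.Iic i) τ hτ hd (M := m)
    (fun j hj => hmono (Finset.mem_Iic.1 hj)) fun t ht =>
      (Finset.sum_le_univ_sum_of_nonneg fun j =>
        mul_nonneg (hτ j).e_pos.le (Nat.cast_nonneg _)).trans (hF.demand_le hτ ht)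
  rw [← Finset.Iio_insert, Finset.sum_insert (by simp)] at key
  have hself : (τ i).dbfStar (τ i).d = (τ i).e := by simp [SporadicTask.dbfStar]
  rw [hself] at key
  have h1 := mul_le_mul_of_nonneg_right hs (mul_pos hm0 hd).le
  rw [sub_mul, ← mul_assoc (1 / (m : ℝ)), one_div_mul_cancel hm0.ne'] at h1
  -- Task `i` is counted `m` times in `hi` but once already in `key`; the remaining `m - 1` copies
  -- produce the `-1/m`.
  have h2 := mul_le_mul_of_nonneg_left he (sub_nonneg.2 hm1)
  have h3 := mul_pos hm0 hd
  linarith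

theorem theorem2 (m : ℕ) (hm : 1 ≤ m) :
    (∀ s : ℝ, 2.5556 - 1 / (m : ℝ) ≤ s → SufficientSpeed m s) ∧
      speedupFactor m ≤ 2.5556 - 1 / (m : ℝ) := by
  refine ⟨fun s hs => sufficientSpeed_of_le hm hs,
    csInf_le ⟨1, fun s hs => hs.1⟩ ⟨?_, sufficientSpeed_of_le hm le_rfl⟩⟩
  have hm1 : (1 : ℝ) ≤ m := by exact_mod_cast hm
  have : 1 / (m : ℝ) ≤ 1 := (div_le_one (by linarith)).2 hm1
  linarith
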